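/- For finite simple graphs $G$ and $H$ and a map $f\colon E(H)\to E(H)$, a copy of $G$ in $H$ (a not necessarily induced subgraph $G'$ of $H$ isomorphic to $G$) is called $f$-free if $f(e)\notin E(G')$ for every $e\in E(G')$. Let $h(n,G)$ denote the maximum number of edges of a graph $H$ on $n$ vertices for which there is a map $f\colon E(H)\to E(H)$ with $f(e)\neq e$ for all $e\in E(H)$ such that $H$ contains no $f$-free copy of $G$. Let $\mathrm{ex}(n,G)$ denote the maximum number of edges of an $n$-vertex graph that does not contain $G$ as a subgraph, and let $tK_2$ be the graph consisting of $t$ pairwise vertex-disjoint edges. (1) $h(n,2K_2)=n$ for all $n\ge 7$, and $h(4,2K_2)=6$, $h(5,2K_2)=h(6,2K_2)=7$. (2) For every $t\ge 3$ there exists $n_t$ such that for all $n\ge n_t$, $$h(n,tK_2)=\mathrm{ex}(n,tK_2)+t-1=(t-1)(n-t+1)+\binom{t-1}{2}+(t-1).$$ -/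

import Mathlib

namespace EdgeMapping

/-- `copies k G` is `kG`, the vertex-disjoint union of `k` copies of `G`. -/
def copies {W : Type*} (k : ℕ) (G : SimpleGraph W) : SimpleGraph (Fin k × W) where
  Adj x y := x.1 = y.1 ∧ G.Adj x.2 y.2
  symm := ⟨fun _ _ h => ⟨h.1.symm, h.2.symm⟩⟩
  loopless := ⟨fun _ h => h.2.ne rfl⟩

/-- `matching t` is `tK₂`, the graph consisting of `t` disjoint edges. -/
abbrev matching (t : ℕ) : SimpleGraph (Fin t × Fin 2) :=
  copies t (SimpleGraph.completeGraph (Fin 2))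

/-- A copy `φ` of `G` in `H` is `f`-free if no edge of the copy is mapped by `f` to an edge of
the copy. -/
def IsFreeCopy {V W : Type*} {G : SimpleGraph W} {H : SimpleGraph V}
    (f : H.edgeSet → H.edgeSet) (φ : G.Copy H) : Prop :=
  ∀ e : G.edgeSet, f (φ.mapEdgeSet e) ∉ Set.range φ.mapEdgeSet

/-- There is a fixed-point-free map `f : E(H) → E(H)` such that `H` has no `f`-free copy of `G`. -/
def Avoids {V W : Type*} (G : SimpleGraph W) (H : SimpleGraph V) : Prop :=
  ∃ f : H.edgeSet → H.edgeSet, (∀ e, f e ≠ e) ∧ ∀ φ : G.Copy H, ¬ IsFreeCopy f φ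

/-- The numbers of edges of the `n`-vertex graphs `H` that admit a fixed-point-free map
`f : E(H) → E(H)` with no `f`-free copy of `G`. -/
def hSet {W : Type*} (n : ℕ) (G : SimpleGraph W) : Set ℕ :=
  {m | ∃ H : SimpleGraph (Fin n), H.edgeSet.ncard = m ∧ Avoids G H}

/-- `h(n, G)`, the maximum of `hSet n G`. -/
noncomputable def h {W : Type*} (n : ℕ) (G : SimpleGraph W) : ℕ :=
  sSup (hSet n G)

theorem finite_hSet {W : Type*} (n : ℕ) (G : SimpleGraph W) : (hSet n G).Finite :=
  (Set.finite_range fun H : SimpleGraph (Fin n) => H.edgeSet.ncard).subset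
    fun _ ⟨H, hm, _⟩ => ⟨H, hm⟩

theorem zero_mem_hSet {W : Type*} (n : ℕ) {G : SimpleGraph W} (hG : G ≠ ⊥) :
    0 ∈ hSet n G := by
  have : IsEmpty (⊥ : SimpleGraph (Fin n)).edgeSet := by simp
  refine ⟨⊥, by simp, isEmptyElim, isEmptyElim, fun φ => ?_⟩
  exact absurd ⟨φ⟩ (SimpleGraph.free_bot hG)

/-- The supremum defining `h(n, G)` is an attained maximum whenever `G` has an edge. -/
theorem isGreatest_h {W : Type*} (n : ℕ) {G : SimpleGraph W} (hG : G ≠ ⊥) :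
    IsGreatest (hSet n G) (h n G) :=
  ⟨Nat.sSup_mem ⟨0, zero_mem_hSet n hG⟩ (finite_hSet n G).bddAbove,
    fun _ hm => le_csSup (finite_hSet n G).bddAbove hm⟩

end EdgeMapping

/-!
Both lower bounds for large `n` come from one graph: join a set `A` of `t - 1` vertices to
everything, and add a star with `t - 1` leaves outside `A`. The map sends each edge at `A` to the
star edge assigned to one of its endpoints in `A`; a matching with `t` edges contains one star edge
and covers `A` with the others, so it contains an edge together with its image.

For the upper bounds, if the members of a list of large families of edges meet each other
sparsely, then a free matching picks one edge from each family, because only a small proportion of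
the tuples is spoilt by a given pair of families. Hence fewer than `t` vertices have large degree.
If fewer than `t - 1` do, the edges missing them contain a large matching and thus a free one. If
exactly `t - 1` do, each of them forbids at most one edge missing them all, namely one that is the
image of more than half of its edges; any other such edge extends to a free matching.

For `2K₂` the hypothesis says that of any two disjoint edges one is the image of the other. Since
an edge has a single image, a double count of the disjoint pairs formed by an edge at a vertex `v`
of maximum degree and an edge avoiding `v` leaves only small cases.
-/

namespace EdgeMapping

open Finset

variable {V : Type*}

/-- A finite set of edges is a matching if distinct members share no vertex. -/
def IsMatching (M : Finset (Sym2 V)) : Prop :=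
  ∀ e ∈ M, ∀ e' ∈ M, ∀ v, v ∈ e → v ∈ e' → e = e'

/-- A finite set is `f`-free if `f` maps no member to a member; for the edge set of a copy of a
graph this is `IsFreeCopy`. -/
def IsFree {α : Type*} (f : α → α) (M : Finset α) : Prop :=
  ∀ e ∈ M, f e ∉ M

/-- `H` contains an `f`-free matching with `t` edges. The map `f` is defined on all pairs of
vertices, but only its values on the edges of `H` matter. -/
def HasFreeMatching (H : SimpleGraph V) (f : Sym2 V → Sym2 V) (t : ℕ) : Prop :=
  ∃ M : Finset (Sym2 V), ↑M ⊆ H.edgeSet ∧ IsMatching M ∧ #M = t ∧ IsFree f M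

theorem IsMatching.subset {M N : Finset (Sym2 V)} (hM : IsMatching M) (h : N ⊆ M) :
    IsMatching N :=
  fun e he e' he' => hM e (h he) e' (h he')

theorem IsMatching.insert [DecidableEq V] {M : Finset (Sym2 V)} (hM : IsMatching M) {e : Sym2 V}
    (he : ∀ e' ∈ M, ∀ v ∈ e, v ∉ e') : IsMatching (insert e M) := by
  intro x hx y hy v hvx hvy
  rcases mem_insert.1 hx with rfl | hxM <;> rcases mem_insert.1 hy with rfl | hyM
  · rfl
  · exact absurd hvy (he y hyM v hvx)
  · exact absurd hvx (he x hxM v hvy)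
  · exact hM x hxM y hyM v hvx hvy

theorem ne_of_forall_notMem {e e' : Sym2 V} (h : ∀ v ∈ e, v ∉ e') : e ≠ e' := by
  rintro rfl
  exact h _ e.out_fst_mem e.out_fst_mem

/-! ### Copies of `tK₂` and matchings -/

section Copies

variable {H : SimpleGraph V} {t : ℕ}

theorem edgeSet_matching (t : ℕ) :
    (matching t).edgeSet = Set.range fun i : Fin t => s((i, 0), (i, 1)) := by
  ext e
  induction e with | _ x y
  obtain ⟨i, a⟩ := x
  obtain ⟨j, b⟩ := y
  fin_cases a <;> fin_cases b <;> simp [copies, eq_comm]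

theorem range_mapEdgeSet (φ : (matching t).Copy H) :
    Set.range (fun x => (φ.mapEdgeSet x : Sym2 V)) =
      Set.range fun i : Fin t => s(φ (i, 0), φ (i, 1)) := by
  change Set.range (fun x : (matching t).edgeSet => Sym2.map φ x) = _
  rw [← Set.image_eq_range, edgeSet_matching, ← Set.range_comp]
  rfl

theorem exists_isMatching_of_copy (φ : (matching t).Copy H) :
    ∃ M : Finset (Sym2 V), (M : Set (Sym2 V)) = Set.range (fun x => (φ.mapEdgeSet x : Sym2 V)) ∧
      ↑M ⊆ H.edgeSet ∧ IsMatching M ∧ #M = t := by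
  obtain ⟨M, hM⟩ := (Set.finite_range fun x => (φ.mapEdgeSet x : Sym2 V)).exists_finset_coe
  have eq_of_mem : ∀ i j v, v ∈ s(φ (i, 0), φ (i, 1)) → v ∈ s(φ (j, 0), φ (j, 1)) → i = j := by
    intro i j v hi hj
    rcases Sym2.mem_iff.1 hi with rfl | rfl <;> rcases Sym2.mem_iff.1 hj with h | h <;>
      exact congrArg Prod.fst (φ.injective h)
  refine ⟨M, hM, ?_, ?_, ?_⟩
  · rw [hM]
    exact Set.range_subset_iff.2 fun x => (φ.mapEdgeSet x).2
  · intro e he e' he' v hv hv'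
    rw [← mem_coe, hM, range_mapEdgeSet] at he he'
    obtain ⟨i, rfl⟩ := he
    obtain ⟨j, rfl⟩ := he'
    rw [eq_of_mem i j v hv hv']
  · rw [← Set.ncard_coe_finset, hM, range_mapEdgeSet, Set.ncard_range_of_injective, Nat.card_fin]
    intro i j (hij : s(φ (i, 0), φ (i, 1)) = s(φ (j, 0), φ (j, 1)))
    exact eq_of_mem i j _ (Sym2.mem_mk_left _ _) (hij ▸ Sym2.mem_mk_left _ _)

theorem IsMatching.exists_copy {M : Finset (Sym2 V)} (hM : IsMatching M)
    (hMH : ↑M ⊆ H.edgeSet) (hcard : #M = t) :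
    ∃ φ : (matching t).Copy H,
      (M : Set (Sym2 V)) = Set.range fun x => (φ.mapEdgeSet x : Sym2 V) := by
  let g : Fin t ≃ M := (M.equivFinOfCardEq hcard).symm
  choose x hx using fun i => Quot.exists_rep (g i : Sym2 V)
  let p : Fin t × Fin 2 → V := fun q => ![(x q.1).1, (x q.1).2] q.2
  have hp : ∀ i, s(p (i, 0), p (i, 1)) = (g i : Sym2 V) := hx
  have hadj : ∀ i, H.Adj (p (i, 0)) (p (i, 1)) := by
    intro i
    rw [← SimpleGraph.mem_edgeSet, hp]
    exact hMH (g i).2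
  have hmem : ∀ q, p q ∈ (g q.1 : Sym2 V) := by
    rintro ⟨i, a⟩
    rw [← hp]
    fin_cases a <;> simp
  have hom : ∀ {q q'}, (matching t).Adj q q' → H.Adj (p q) (p q') := by
    rintro ⟨i, a⟩ ⟨j, b⟩ ⟨hij, hab⟩
    obtain rfl : i = j := hij
    fin_cases a <;> fin_cases b
    exacts [absurd rfl hab.ne, hadj i, (hadj i).symm, absurd rfl hab.ne]
  have hinj : Function.Injective p := by
    rintro ⟨i, a⟩ ⟨j, b⟩ hij
    obtain rfl : i = j := g.injective <| Subtype.ext <|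
      hM _ (g i).2 _ (g j).2 (p (i, a)) (hmem (i, a)) (hij ▸ hmem (j, b))
    by_contra hab
    exact (hom (q := (i, a)) (q' := (i, b)) ⟨rfl, fun h => hab (congrArg _ h)⟩).ne hij
  refine ⟨⟨⟨p, hom⟩, hinj⟩, ?_⟩
  rw [range_mapEdgeSet]
  change _ = Set.range fun i => s(p (i, 0), p (i, 1))
  simp only [hp]
  rw [← Function.comp_def, g.surjective.range_comp, Subtype.range_coe]

theorem free_matching_iff :
    (matching t).Free H ↔
      ¬ ∃ M : Finset (Sym2 V), ↑M ⊆ H.edgeSet ∧ IsMatching M ∧ #M = t := by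
  refine not_congr ⟨?_, ?_⟩
  · rintro ⟨φ⟩
    obtain ⟨M, -, hM⟩ := exists_isMatching_of_copy φ
    exact ⟨M, hM⟩
  · rintro ⟨M, hMH, hM, hcard⟩
    obtain ⟨φ, -⟩ := hM.exists_copy hMH hcard
    exact ⟨φ⟩

theorem avoids_matching_iff :
    Avoids (matching t) H ↔ ∃ f : Sym2 V → Sym2 V,
      (∀ e ∈ H.edgeSet, f e ∈ H.edgeSet ∧ f e ≠ e) ∧ ¬ HasFreeMatching H f t := by
  classical
  constructor
  · rintro ⟨f, hf, hφ⟩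
    refine ⟨fun e => if he : e ∈ H.edgeSet then f ⟨e, he⟩ else e, fun e he => ?_, ?_⟩
    · simpa only [he, dite_true] using ⟨(f ⟨e, he⟩).2, fun h => hf ⟨e, he⟩ (Subtype.ext h)⟩
    rintro ⟨M, hMH, hM, hcard, hfree⟩
    obtain ⟨φ, hrange⟩ := hM.exists_copy hMH hcard
    refine hφ φ fun x ⟨y, hy⟩ => hfree (φ.mapEdgeSet x) (hrange.superset ⟨x, rfl⟩) ?_
    simp only [Subtype.coe_prop, dite_true, Subtype.coe_eta, ← hy]
    exact hrange.superset ⟨y, rfl⟩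
  · rintro ⟨f, hf, hfree⟩
    refine ⟨fun e => ⟨f e, (hf e e.2).1⟩, fun e h => (hf e e.2).2 (congrArg Subtype.val h),
      fun φ hφ => hfree ?_⟩
    obtain ⟨M, hrange, hMH, hM, hcard⟩ := exists_isMatching_of_copy φ
    refine ⟨M, hMH, hM, hcard, fun e he hfe => ?_⟩
    obtain ⟨x, rfl⟩ := hrange.subset he
    obtain ⟨y, hy⟩ := hrange.subset hfe
    exact hφ x ⟨y, Subtype.ext hy⟩

end Copies

/-! ### Free matchings with one edge from each of several large families -/

section Transversal

variable {ι α : Type*} [Fintype ι]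

theorem card_filter_piFinset_mul_card_le [DecidableEq ι] (S : ι → Finset α) (R : α → α → Prop)
    [DecidableRel R] {d : ℕ} {i j : ι} (hij : i ≠ j) (hR : ∀ x ∈ S i, #{y ∈ S j | R x y} ≤ d) :
    #{c ∈ Fintype.piFinset S | R (c i) (c j)} * #(S j) ≤ #(Fintype.piFinset S) * d := by
  calc #{c ∈ Fintype.piFinset S | R (c i) (c j)} * #(S j)
      = #({c ∈ Fintype.piFinset S | R (c i) (c j)} ×ˢ S j) := (card_product _ _).symm
    _ ≤ #((Fintype.piFinset S).sigma fun c => {y ∈ S j | R (c i) y}) := by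
        -- exchange the `j`-th coordinate of the tuple with the separate element of `S j`
        refine card_le_card_of_injOn (fun p => ⟨Function.update p.1 j p.2, p.1 j⟩) ?_ ?_
        · rintro ⟨c, y⟩ hp
          simp only [mem_coe, mem_product, mem_filter, Fintype.mem_piFinset] at hp
          simp only [mem_coe, mem_sigma, mem_filter, Fintype.mem_piFinset,
            Function.update_of_ne hij]
          refine ⟨fun l => ?_, hp.1.1 j, hp.1.2⟩
          obtain rfl | hl := eq_or_ne l j
          · rw [Function.update_self]
            exact hp.2
          · rw [Function.update_of_ne hl]
            exact hp.1.1 l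
        · rintro ⟨c, y⟩ - ⟨c', y'⟩ - heq
          simp only [Sigma.mk.injEq, heq_eq_eq] at heq
          obtain ⟨hupdate, hj⟩ := heq
          refine Prod.ext (funext fun l => ?_) ?_
          · obtain rfl | hl := eq_or_ne l j
            · exact hj
            · simpa only [Function.update_of_ne hl] using congrFun hupdate l
          · simpa only [Function.update_self] using congrFun hupdate j
    _ ≤ #(Fintype.piFinset S) * d := by
        rw [card_sigma]
        exact sum_le_card_nsmul _ _ _ fun c hc => hR _ (Fintype.mem_piFinset.1 hc i)

theorem exists_transversal (S : ι → Finset α) (R : α → α → Prop) [DecidableRel R] {d : ℕ}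
    (hS : ∀ i, d * Fintype.card ι ^ 2 < #(S i))
    (hR : ∀ i j, i ≠ j → ∀ x ∈ S i, #{y ∈ S j | R x y} ≤ d) :
    ∃ c : ι → α, (∀ i, c i ∈ S i) ∧ ∀ i j, i ≠ j → ¬ R (c i) (c j) := by
  classical
  by_contra! hbad
  let P := Fintype.piFinset S
  have hP : 0 < #P := by
    rw [Fintype.card_piFinset]
    exact prod_pos fun i _ => (Nat.zero_le _).trans_lt (hS i)
  have hcover : P ⊆ (univ : Finset ι).offDiag.biUnion fun q => {c ∈ P | R (c q.1) (c q.2)} := by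
    intro c hc
    obtain ⟨i, j, hij, hR⟩ := hbad c (Fintype.mem_piFinset.1 hc)
    simp only [mem_biUnion, mem_offDiag, mem_filter, mem_univ, true_and]
    exact ⟨(i, j), hij, hc, hR⟩
  have hpair : ∀ q ∈ (univ : Finset ι).offDiag,
      #{c ∈ P | R (c q.1) (c q.2)} * (d * Fintype.card ι ^ 2 + 1) ≤ #P * d := fun q hq =>
    have hne := (mem_offDiag.1 hq).2.2
    (Nat.mul_le_mul_left _ (hS q.2)).trans
      (card_filter_piFinset_mul_card_le S R hne (hR q.1 q.2 hne))
  have : #P * (d * Fintype.card ι ^ 2 + 1) ≤ #P * (d * Fintype.card ι ^ 2) := by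
    calc #P * (d * Fintype.card ι ^ 2 + 1)
        ≤ (∑ q ∈ (univ : Finset ι).offDiag, #{c ∈ P | R (c q.1) (c q.2)}) *
            (d * Fintype.card ι ^ 2 + 1) :=
          Nat.mul_le_mul_right _ ((card_le_card hcover).trans card_biUnion_le)
      _ ≤ #(univ : Finset ι).offDiag * (#P * d) := by
          rw [sum_mul]
          exact sum_le_card_nsmul _ _ _ hpair
      _ ≤ Fintype.card ι ^ 2 * (#P * d) := by
          refine Nat.mul_le_mul_right _ ?_
          rw [offDiag_card, card_univ, ← sq]
          exact Nat.sub_le _ _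
      _ = #P * (d * Fintype.card ι ^ 2) := by ring
  exact absurd (Nat.le_of_mul_le_mul_left this hP) (by omega)

open scoped Classical in
theorem exists_isMatching_isFree_of_family (S : ι → Finset (Sym2 V)) {f : Sym2 V → Sym2 V} {k : ℕ}
    (hS : ∀ i, (k + 1) * Fintype.card ι ^ 2 < #(S i))
    (hmeet : ∀ i j, i ≠ j → ∀ e ∈ S i, #{e' ∈ S j | ∃ v ∈ e, v ∈ e'} ≤ k)
    (hf : ∀ i, ∀ e ∈ S i, f e ≠ e) :
    ∃ M, IsMatching M ∧ #M = Fintype.card ι ∧ IsFree f M ∧ ∀ e ∈ M, ∃ i, e ∈ S i := by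
  obtain ⟨c, hcS, hc⟩ := exists_transversal S (fun e e' => (∃ v ∈ e, v ∈ e') ∨ f e = e') hS
    fun i j hij e he => by
      rw [filter_or]
      refine (card_union_le _ _).trans (Nat.add_le_add (hmeet i j hij e he) ?_)
      rw [filter_eq]
      split_ifs <;> simp
  push Not at hc
  have hinj : Function.Injective c := fun i j hij => by
    by_contra hne
    exact ne_of_forall_notMem (hc i j hne).1 hij
  refine ⟨univ.image c, ?_, by rw [card_image_of_injective _ hinj, card_univ], ?_, ?_⟩
  · simp only [IsMatching, mem_image, mem_univ, true_and, forall_exists_index,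
      forall_apply_eq_imp_iff]
    intro i j v hi hj
    by_contra hne
    exact (hc i j fun h => hne (congrArg c h)).1 v hi hj
  · simp only [IsFree, mem_image, mem_univ, true_and, forall_exists_index,
      forall_apply_eq_imp_iff, not_exists]
    intro i j hij
    obtain rfl | hne := eq_or_ne i j
    · exact hf i _ (hcS i) hij.symm
    · exact (hc i j hne).2 hij.symm
  · simp only [mem_image, mem_univ, true_and, forall_exists_index, forall_apply_eq_imp_iff]
    exact fun i => ⟨i, hcS i⟩

theorem exists_isMatching_isFree_of_star {A : Finset V} {N : V → Finset V} {f : Sym2 V → Sym2 V}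
    (hN : ∀ a ∈ A, 2 * #A ^ 2 < #(N a)) (hA : ∀ a ∈ A, Disjoint (N a) A)
    (hf : ∀ a ∈ A, ∀ b ∈ N a, f s(a, b) ≠ s(a, b)) :
    ∃ M, IsMatching M ∧ #M = #A ∧ IsFree f M ∧ ∀ e ∈ M, ∃ a ∈ A, ∃ b ∈ N a, e = s(a, b) := by
  classical
  let S : A → Finset (Sym2 V) := fun a => (N a).image fun b => s((a : V), b)
  have hS : ∀ a, (1 + 1) * Fintype.card A ^ 2 < #(S a) := fun a => by
    rw [card_image_of_injective _ fun _ _ => Sym2.congr_right.1, Fintype.card_coe]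
    exact hN a a.2
  have hmeet : ∀ a a', a ≠ a' → ∀ e ∈ S a, #{e' ∈ S a' | ∃ v ∈ e, v ∈ e'} ≤ 1 := by
    rintro ⟨a, ha⟩ ⟨a', ha'⟩ hne e he
    obtain ⟨b, hb, rfl⟩ := mem_image.1 he
    refine (card_le_card (t := {s(a', b)}) fun e' he' => ?_).trans_eq (card_singleton _)
    obtain ⟨he', v, hv, hv'⟩ := mem_filter.1 he'
    obtain ⟨b', hb', rfl⟩ := mem_image.1 he'
    have h₁ : b ≠ a' := fun h => disjoint_left.1 (hA a ha) hb (h ▸ ha')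
    have h₂ : b' ≠ a := fun h => disjoint_left.1 (hA a' ha') hb' (h ▸ ha)
    have h₃ : a ≠ a' := fun h => hne (Subtype.ext h)
    simp only [Sym2.mem_iff] at hv hv'
    rw [mem_singleton]
    grind
  obtain ⟨M, hM, hcard, hfree, hMS⟩ := exists_isMatching_isFree_of_family S hS hmeet
    fun a => forall_mem_image.2 (hf a a.2)
  refine ⟨M, hM, by rw [hcard, Fintype.card_coe], hfree, fun e he => ?_⟩
  obtain ⟨a, ha⟩ := hMS e he
  obtain ⟨b, hb, rfl⟩ := mem_image.1 ha
  exact ⟨a, a.2, b, hb, rfl⟩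

theorem IsMatching.exists_subset_isFree {M : Finset (Sym2 V)} (hM : IsMatching M) {t : ℕ}
    (ht : 2 * t ^ 2 < #M) {f : Sym2 V → Sym2 V} (hf : ∀ e ∈ M, f e ≠ e) :
    ∃ N ⊆ M, #N = t ∧ IsFree f N := by
  classical
  obtain ⟨N, -, hcard, hfree, hNM⟩ := exists_isMatching_isFree_of_family (ι := Fin t) (k := 1)
    (fun _ => M) (by simpa only [Fintype.card_fin] using fun _ => ht)
    (fun _ _ _ e he => card_le_one.2 fun e₁ h₁ e₂ h₂ => by
      obtain ⟨h₁, v, hv, hv₁⟩ := mem_filter.1 h₁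
      obtain ⟨h₂, w, hw, hw₂⟩ := mem_filter.1 h₂
      exact (hM e he e₁ h₁ v hv hv₁).symm.trans (hM e he e₂ h₂ w hw hw₂)) fun _ => hf
  exact ⟨N, fun e he => (hNM e he).elim fun _ h => h, hcard.trans (Fintype.card_fin t), hfree⟩

theorem hasFreeMatching_of_isMatching {H : SimpleGraph V} {f : Sym2 V → Sym2 V}
    (hf : ∀ e ∈ H.edgeSet, f e ≠ e) {M : Finset (Sym2 V)} (hM : IsMatching M)
    (hMH : ↑M ⊆ H.edgeSet) {t : ℕ} (ht : 2 * t ^ 2 < #M) : HasFreeMatching H f t :=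
  let ⟨N, hNM, hcard, hfree⟩ := hM.exists_subset_isFree ht fun e he => hf e (hMH he)
  ⟨N, (coe_subset.2 hNM).trans hMH, hM.subset hNM, hcard, hfree⟩

end Transversal

/-! ### Split graphs -/

section SplitGraph

/-- The complete split graph on `A`: the vertices in `A` are adjacent to all other vertices, and
the vertices outside `A` are pairwise nonadjacent. It is the extremal graph for `tK₂` when
`#A = t - 1`. -/
def splitGraph (A : Finset V) : SimpleGraph V where
  Adj x y := x ≠ y ∧ (x ∈ A ∨ y ∈ A)
  symm := ⟨fun _ _ h => ⟨h.1.symm, h.2.symm⟩⟩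
  loopless := ⟨fun _ h => h.1 rfl⟩

instance [DecidableEq V] (A : Finset V) : DecidableRel (splitGraph A).Adj :=
  fun x y => inferInstanceAs (Decidable (x ≠ y ∧ (x ∈ A ∨ y ∈ A)))

theorem mem_edgeSet_splitGraph {A : Finset V} {e : Sym2 V} :
    e ∈ (splitGraph A).edgeSet ↔ ¬ e.IsDiag ∧ ∃ a ∈ A, a ∈ e := by
  induction e with | _ x y
  simp only [SimpleGraph.mem_edgeSet, splitGraph, Sym2.mk_isDiag_iff, Sym2.mem_iff]
  grind

variable [Fintype V] [DecidableEq V]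

theorem degree_splitGraph (A : Finset V) (v : V) :
    (splitGraph A).degree v = if v ∈ A then Fintype.card V - 1 else #A := by
  have hN : (splitGraph A).neighborFinset v = if v ∈ A then univ.erase v else A := by
    ext w
    rw [SimpleGraph.mem_neighborFinset]
    split_ifs with hv <;> simp only [splitGraph, mem_erase, mem_univ] <;> grind
  rw [← SimpleGraph.card_neighborFinset_eq_degree, hN, apply_ite card,
    card_erase_of_mem (mem_univ v), card_univ]

theorem card_edgeFinset_splitGraph (A : Finset V) :
    #(splitGraph A).edgeFinset = #A * (Fintype.card V - #A) + (#A).choose 2 := by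
  have hsum : ∑ v, (splitGraph A).degree v =
      #A * (Fintype.card V - 1) + (Fintype.card V - #A) * #A := by
    simp only [degree_splitGraph, sum_ite, sum_const, smul_eq_mul, filter_mem_eq_inter,
      univ_inter, filter_notMem_eq_sdiff, ← compl_eq_univ_sdiff, card_compl]
  have hchoose : 2 * (#A).choose 2 = #A * (#A - 1) := by
    rw [Nat.choose_two_right, Nat.two_mul_div_two_of_even (Nat.even_mul_pred_self _)]
  rw [SimpleGraph.sum_degrees_eq_twice_card_edges] at hsum
  obtain ⟨m, hm⟩ := Nat.exists_eq_add_of_le (card_le_univ A)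
  rw [hm, Nat.add_sub_cancel_left] at hsum ⊢
  cases hA : #A with
  | zero => simp_all
  | succ u =>
    rw [hA] at hsum hchoose
    rw [show u + 1 + m - 1 = u + m by omega] at hsum
    rw [Nat.add_sub_cancel] at hchoose
    linarith

theorem card_edgeFinset_le_splitGraph_add (H : SimpleGraph V) [DecidableRel H.Adj]
    (A : Finset V) :
    #H.edgeFinset ≤ #A * (Fintype.card V - #A) + (#A).choose 2 +
      #{e ∈ H.edgeFinset | ∀ a ∈ A, a ∉ e} := by
  rw [← card_edgeFinset_splitGraph]
  refine (card_le_card fun e he => ?_).trans (card_union_le _ _)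
  rw [mem_union, mem_filter, SimpleGraph.mem_edgeFinset, mem_edgeSet_splitGraph]
  have := H.not_isDiag_of_mem_edgeSet (SimpleGraph.mem_edgeFinset.1 he)
  grind

end SplitGraph

/-! ### Graphs without free matchings -/

section UpperBound

theorem exists_isMatching_card_le_mul [DecidableEq V] {F : Finset (Sym2 V)} {K : ℕ}
    (hF : ∀ v, #{e ∈ F | v ∈ e} ≤ K) : ∃ M ⊆ F, IsMatching M ∧ #F ≤ 2 * K * #M := by
  classical
  obtain ⟨M, hM, hmax⟩ := exists_max_image {M ∈ F.powerset | IsMatching M} card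
    ⟨∅, mem_filter.2 ⟨empty_mem_powerset _, fun _ he => absurd he (notMem_empty _)⟩⟩
  obtain ⟨hMF, hM⟩ := mem_filter.1 hM
  rw [mem_powerset] at hMF
  have hcover : F ⊆ (M.biUnion Sym2.toFinset).biUnion fun v => {e ∈ F | v ∈ e} := by
    intro e he
    simp only [mem_biUnion, mem_filter, Sym2.mem_toFinset]
    by_contra! hdisj
    have hdisj' : ∀ e' ∈ M, ∀ v ∈ e, v ∉ e' := fun e' he' v hv hv' => hdisj v ⟨e', he', hv'⟩ he hv
    have hlt := hmax (insert e M) (mem_filter.2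
      ⟨mem_powerset.2 (insert_subset he hMF), hM.insert hdisj'⟩)
    rw [card_insert_of_notMem fun h => ne_of_forall_notMem (hdisj' e h) rfl] at hlt
    omega
  refine ⟨M, hMF, hM, ?_⟩
  calc #F ≤ #(M.biUnion Sym2.toFinset) * K :=
        (card_le_card hcover).trans (card_biUnion_le_card_mul _ _ _ fun v _ => hF v)
    _ ≤ #M * 2 * K := Nat.mul_le_mul_right _ <| card_biUnion_le_card_mul _ _ _ fun e _ => by
        rw [Sym2.card_toFinset]
        split_ifs <;> simp
    _ = 2 * K * #M := by ring

theorem hasFreeMatching_insert {H : SimpleGraph V} {f : Sym2 V → Sym2 V} {M : Finset (Sym2 V)}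
    {e₀ : Sym2 V} (he₀ : e₀ ∈ H.edgeSet) (hMH : ↑M ⊆ H.edgeSet) (hM : IsMatching M)
    (hfree : IsFree f M) (hfe₀ : f e₀ ≠ e₀) (hdisj : ∀ e ∈ M, ∀ v ∈ e₀, v ∉ e)
    (hMe₀ : ∀ e ∈ M, f e ≠ e₀ ∧ e ≠ f e₀) : HasFreeMatching H f (#M + 1) := by
  classical
  refine ⟨insert e₀ M, ?_, hM.insert hdisj,
    card_insert_of_notMem fun h => ne_of_forall_notMem (hdisj e₀ h) rfl, ?_⟩
  · rw [coe_insert]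
    exact Set.insert_subset he₀ hMH
  · intro e he hfe
    rcases mem_insert.1 he with rfl | he <;> rcases mem_insert.1 hfe with hfe | hfe
    · exact hfe₀ hfe
    · exact (hMe₀ _ hfe).2 rfl
    · exact (hMe₀ e he).1 hfe
    · exact hfree e he hfe

variable [Fintype V] {H : SimpleGraph V} [DecidableRel H.Adj]
  {f : Sym2 V → Sym2 V}

theorem hasFreeMatching_of_degree (hf : ∀ e ∈ H.edgeSet, f e ≠ e) {A : Finset V}
    (hA : ∀ a ∈ A, 2 * #A ^ 2 + #A < H.degree a) : HasFreeMatching H f #A := by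
  classical
  obtain ⟨M, hM, hcard, hfree, hMA⟩ := exists_isMatching_isFree_of_star (A := A) (f := f)
    (N := fun a => H.neighborFinset a \ A)
    (fun a ha => by
      have := le_card_sdiff A (H.neighborFinset a)
      have := hA a ha
      rw [← H.card_neighborFinset_eq_degree] at this
      omega)
    (fun _ _ => sdiff_disjoint)
    (fun a _ b hb => hf _ ((H.mem_neighborFinset a b).1 (mem_sdiff.1 hb).1))
  refine ⟨M, fun e he => ?_, hM, hcard, hfree⟩
  obtain ⟨a, -, b, hb, rfl⟩ := hMA e he
  exact (H.mem_neighborFinset a b).1 (mem_sdiff.1 hb).1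

theorem hasFreeMatching_of_edge [DecidableEq V] (hf : ∀ e ∈ H.edgeSet, f e ≠ e) {A : Finset V}
    {e₀ : Sym2 V} (he₀ : e₀ ∈ H.edgeSet) (hAe₀ : ∀ a ∈ A, a ∉ e₀)
    (hA : ∀ a ∈ A, 2 * #A ^ 2 + #A + 3 < #{b ∈ H.neighborFinset a | f s(a, b) ≠ e₀}) :
    HasFreeMatching H f (#A + 1) := by
  let B : V → Finset V := fun a =>
    A ∪ (e₀.toFinset ∪ {b ∈ H.neighborFinset a | s(a, b) = f e₀})
  have hB : ∀ a, #(B a) ≤ #A + 3 := fun a => by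
    have h₁ : #e₀.toFinset = 2 :=
      Sym2.card_toFinset_of_not_isDiag _ (H.not_isDiag_of_mem_edgeSet he₀)
    have h₂ : #{b ∈ H.neighborFinset a | s(a, b) = f e₀} ≤ 1 :=
      card_le_one.2 fun b hb b' hb' =>
        Sym2.congr_right.1 ((mem_filter.1 hb).2.trans (mem_filter.1 hb').2.symm)
    exact (card_union_le _ _).trans <| Nat.add_le_add_left
      ((card_union_le _ _).trans (Nat.add_le_add h₁.le h₂)) _
  have hmem : ∀ {a b}, b ∈ {b ∈ H.neighborFinset a | f s(a, b) ≠ e₀} \ B a →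
      H.Adj a b ∧ f s(a, b) ≠ e₀ ∧ b ∉ A ∧ b ∉ e₀ ∧ s(a, b) ≠ f e₀ := by
    intro a b hb
    simp only [B, mem_sdiff, mem_filter, mem_union, Sym2.mem_toFinset,
      SimpleGraph.mem_neighborFinset, not_or, not_and] at hb
    exact ⟨hb.1.1, hb.1.2, hb.2.1, hb.2.2.1, hb.2.2.2 hb.1.1⟩
  obtain ⟨M, hM, hcard, hfree, hMA⟩ := exists_isMatching_isFree_of_star (A := A) (f := f)
    (N := fun a => {b ∈ H.neighborFinset a | f s(a, b) ≠ e₀} \ B a)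
    (fun a ha => by
      have := le_card_sdiff (B a) {b ∈ H.neighborFinset a | f s(a, b) ≠ e₀}
      have := hA a ha
      have := hB a
      omega)
    (fun _ _ => disjoint_left.2 fun _ hb => (hmem hb).2.2.1)
    (fun _ _ _ hb => hf _ (hmem hb).1)
  have hdisj : ∀ e ∈ M, ∀ v ∈ e₀, v ∉ e := by
    intro e he v hv hve
    obtain ⟨a, ha, b, hb, rfl⟩ := hMA e he
    rcases Sym2.mem_iff.1 hve with rfl | rfl
    · exact hAe₀ v ha hv
    · exact (hmem hb).2.2.2.1 hv
  rw [← hcard]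
  refine hasFreeMatching_insert he₀ (fun e he => ?_) hM hfree (hf _ he₀) hdisj fun e he => ?_ <;>
    obtain ⟨a, -, b, hb, rfl⟩ := hMA e he
  · exact (hmem hb).1
  · exact ⟨(hmem hb).2.1, (hmem hb).2.2.2.2⟩

theorem exists_edge_of_card_lt [DecidableEq V] {A : Finset V} {F : Finset (Sym2 V)}
    (hAF : #A < #F) :
    ∃ e ∈ F, ∀ a ∈ A, H.degree a ≤ 2 * #{b ∈ H.neighborFinset a | f s(a, b) ≠ e} := by
  have : Nonempty V := (card_pos.1 (Nat.zero_lt_of_lt hAF)).elim fun e _ => ⟨e.out.1⟩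
  by_contra! hF
  choose! a haA ha using hF
  obtain ⟨e, he, e', he', hne, heq⟩ := exists_ne_map_eq_of_card_lt_of_maps_to hAF haA
  have hcover : H.neighborFinset (a e) ⊆ {b ∈ H.neighborFinset (a e) | f s(a e, b) ≠ e} ∪
      {b ∈ H.neighborFinset (a e) | f s(a e, b) ≠ e'} := by
    intro b hb
    by_cases hfe : f s(a e, b) = e
    · exact mem_union_right _ (mem_filter.2 ⟨hb, fun hfe' => hne (hfe.symm.trans hfe')⟩)
    · exact mem_union_left _ (mem_filter.2 ⟨hb, hfe⟩)
  have h₁ := ha e he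
  have h₂ := ha e' he'
  rw [← heq] at h₂
  have := (card_le_card hcover).trans (card_union_le _ _)
  rw [H.card_neighborFinset_eq_degree] at this
  omega

/-- A number of vertices from which on the extremal results for `tK₂` are proved here; no attempt is
made to optimise it. -/
def threshold (t : ℕ) : ℕ :=
  16 * t ^ 2 * (t ^ 2 + 1) + t ^ 2

theorem le_add_sq_of_mul_sub_le {n u a m : ℕ} (hau : a < u) (hun : u ≤ n)
    (h : u * (n - u) ≤ a * (n - a) + a.choose 2 + m) : n ≤ m + u ^ 2 := by
  have hchoose : a.choose 2 ≤ a ^ 2 := Nat.choose_le_pow ..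
  obtain ⟨j, rfl⟩ := Nat.exists_eq_add_of_lt hau
  obtain ⟨l, rfl⟩ := Nat.exists_eq_add_of_le hun
  rw [Nat.add_sub_cancel_left, show a + j + 1 + l - a = j + 1 + l by omega] at h
  nlinarith

theorem card_filter_mem_le_of_degree_le [DecidableEq V] {A : Finset V} {K : ℕ}
    (hA : ∀ v ∉ A, H.degree v ≤ K) (v : V) :
    #{e ∈ {e ∈ H.edgeFinset | ∀ a ∈ A, a ∉ e} | v ∈ e} ≤ K := by
  by_cases hv : v ∈ A
  · rw [filter_filter, filter_false_of_mem fun e _ ⟨hAe, hve⟩ => hAe v hv hve]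
    exact Nat.zero_le _
  · refine (card_le_card (filter_subset_filter _ (filter_subset _ _))).trans ?_
    rw [← H.incidenceFinset_eq_filter, H.card_incidenceFinset_eq_degree]
    exact hA v hv

theorem hasFreeMatching_of_card_edgeFinset_le [DecidableEq V]
    (hf : ∀ e ∈ H.edgeSet, f e ≠ e) {u r : ℕ} (hn : threshold (u + 1) ≤ Fintype.card V)
    (hE : u * (Fintype.card V - u) + u.choose 2 + r ≤ #H.edgeFinset)
    (hr : ∀ A : Finset V, #A = u → ∀ F ⊆ H.edgeFinset, r ≤ #F → ∃ e ∈ F, ∀ a ∈ A,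
      H.degree a ≤ 2 * #{b ∈ H.neighborFinset a | f s(a, b) ≠ e}) :
    HasFreeMatching H f (u + 1) := by
  let A : Finset V := {v | 4 * ((u + 1) ^ 2 + 1) ≤ H.degree v}
  let F := {e ∈ H.edgeFinset | ∀ a ∈ A, a ∉ e}
  have hAdeg : ∀ a ∈ A, 4 * ((u + 1) ^ 2 + 1) ≤ H.degree a := fun a ha => (mem_filter.1 ha).2
  have hEF : #H.edgeFinset ≤ #A * (Fintype.card V - #A) + (#A).choose 2 + #F :=
    card_edgeFinset_le_splitGraph_add H A
  rcases lt_trichotomy #A u with hAu | hAu | hAu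
  · have hFdeg : ∀ v, #{e ∈ F | v ∈ e} ≤ 4 * ((u + 1) ^ 2 + 1) :=
      card_filter_mem_le_of_degree_le fun v hv =>
        (not_le.1 fun h => hv (mem_filter.2 ⟨mem_univ v, h⟩)).le
    obtain ⟨M, hMF, hM, hFM⟩ := exists_isMatching_card_le_mul hFdeg
    refine hasFreeMatching_of_isMatching hf hM (fun e he => SimpleGraph.mem_edgeFinset.1
      (mem_filter.1 (hMF he)).1) (lt_of_not_ge fun hMu => ?_)
    have hFle := hFM.trans (Nat.mul_le_mul_left _ hMu)
    have hF : Fintype.card V ≤ #F + u ^ 2 :=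
      le_add_sq_of_mul_sub_le hAu (by unfold threshold at hn; nlinarith) (by omega)
    unfold threshold at hn
    nlinarith
  · obtain ⟨e, heF, he⟩ := hr A hAu F (filter_subset _ _) (by rw [hAu] at hEF; omega)
    obtain ⟨heH, hAe⟩ := mem_filter.1 heF
    rw [← hAu]
    refine hasFreeMatching_of_edge hf (SimpleGraph.mem_edgeFinset.1 heH) hAe fun a ha => ?_
    have := (hAdeg a ha).trans (he a ha)
    rw [hAu]
    nlinarith
  · obtain ⟨B, hBA, hB⟩ : ∃ B ⊆ A, #B = u + 1 := exists_subset_card_eq hAu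
    rw [← hB]
    refine hasFreeMatching_of_degree hf fun a ha => lt_of_lt_of_le ?_ (hAdeg a (hBA ha))
    rw [hB]
    nlinarith

theorem card_edgeFinset_le_of_free {u : ℕ} (hn : threshold (u + 1) ≤ Fintype.card V)
    (hH : (matching (u + 1)).Free H) :
    #H.edgeFinset ≤ u * (Fintype.card V - u) + u.choose 2 := by
  classical
  rw [free_matching_iff] at hH
  by_contra! hE
  -- no value of this map is an edge of `H`, so every matching in `H` is free
  let f : Sym2 V → Sym2 V := fun e => s(e.out.1, e.out.1)
  have hf : ∀ e e', e' ∈ H.edgeSet → f e ≠ e' := by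
    rintro e _ he' rfl
    exact he'.ne rfl
  obtain ⟨M, hMH, hM, hcard, -⟩ := hasFreeMatching_of_card_edgeFinset_le
    (fun e he => hf e e he) hn hE fun A _ F hF hcard => by
      obtain ⟨e, he⟩ := card_pos.1 hcard
      refine ⟨e, he, fun a _ => ?_⟩
      rw [filter_true_of_mem fun b _ => hf _ e (SimpleGraph.mem_edgeFinset.1 (hF he)),
        H.card_neighborFinset_eq_degree]
      omega
  exact hH ⟨M, hMH, hM, hcard⟩

theorem card_edgeFinset_le_of_avoids {u : ℕ} (hn : threshold (u + 1) ≤ Fintype.card V)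
    (hH : Avoids (matching (u + 1)) H) :
    #H.edgeFinset ≤ u * (Fintype.card V - u) + u.choose 2 + u := by
  classical
  obtain ⟨f, hf, hfree⟩ := avoids_matching_iff.1 hH
  by_contra! hE
  exact hfree <| hasFreeMatching_of_card_edgeFinset_le (fun e he => (hf e he).2) hn hE
    fun A hA F _ hcard => exists_edge_of_card_lt (hA.trans_lt hcard)

end UpperBound

/-! ### Extremal graphs -/

section LowerBound

variable {A : Finset V}

theorem exists_endpoint (A : Finset V) (e : Sym2 V) :
    ∃ v ∈ e, (∃ a ∈ A, a ∈ e) → v ∈ A := by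
  by_cases he : ∃ a ∈ A, a ∈ e
  · obtain ⟨a, ha, hae⟩ := he
    exact ⟨a, hae, fun _ => ha⟩
  · exact ⟨e.out.1, e.out_fst_mem, fun h => absurd h he⟩

theorem IsMatching.injOn {M : Finset (Sym2 V)} (hM : IsMatching M) {w : Sym2 V → V}
    (hw : ∀ e ∈ M, w e ∈ e) : Set.InjOn w M :=
  fun e he e' he' h => hM e he e' he' (w e) (hw e he) (h ▸ hw e' he')

theorem IsMatching.card_le {M : Finset (Sym2 V)} (hM : IsMatching M)
    (hA : ∀ e ∈ M, ∃ a ∈ A, a ∈ e) : #M ≤ #A := by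
  choose w hw hwA using exists_endpoint A
  exact card_le_card_of_injOn w (fun e he => hwA e (hA e he)) (hM.injOn fun e _ => hw e)

theorem free_matching_splitGraph (A : Finset V) : (matching (#A + 1)).Free (splitGraph A) := by
  rw [free_matching_iff]
  rintro ⟨M, hMH, hM, hcard⟩
  have := hM.card_le fun e he => (mem_edgeSet_splitGraph.1 (hMH he)).2
  omega

/-- The complete split graph on `A` together with a star centred at `c` whose leaves are the values
of `d` on `A`. -/
def splitStarGraph (A : Finset V) (c : V) (d : V → V) : SimpleGraph V :=
  splitGraph A ⊔ SimpleGraph.fromEdgeSet ((fun a => s(c, d a)) '' A)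

variable {c : V} {d : V → V}

theorem edgeSet_splitStarGraph (hd : ∀ a ∈ A, d a ≠ c) :
    (splitStarGraph A c d).edgeSet = (splitGraph A).edgeSet ∪ (fun a => s(c, d a)) '' A := by
  rw [splitStarGraph, SimpleGraph.edgeSet_sup, SimpleGraph.edgeSet_fromEdgeSet,
    sdiff_eq_left.2]
  rw [Set.disjoint_left]
  rintro _ ⟨a, ha, rfl⟩ hdiag
  exact hd a ha (Sym2.mk_isDiag_iff.1 hdiag).symm

theorem ncard_edgeSet_splitStarGraph [Fintype V] (hc : c ∉ A) (hd : ∀ a ∈ A, d a ∉ A)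
    (hdc : ∀ a ∈ A, d a ≠ c) (hinj : Set.InjOn d A) :
    (splitStarGraph A c d).edgeSet.ncard =
      #A * (Fintype.card V - #A) + (#A).choose 2 + #A := by
  classical
  have hdisj : Disjoint (splitGraph A).edgeSet ((fun a => s(c, d a)) '' A) := by
    rw [Set.disjoint_right]
    rintro _ ⟨a, ha, rfl⟩ he
    obtain ⟨-, b, hb, hbe⟩ := mem_edgeSet_splitGraph.1 he
    rcases Sym2.mem_iff.1 hbe with rfl | rfl
    exacts [hc hb, hd a ha hb]
  rw [edgeSet_splitStarGraph hdc, Set.ncard_union_eq hdisj, ← SimpleGraph.coe_edgeFinset,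
    Set.ncard_coe_finset, card_edgeFinset_splitGraph, Set.InjOn.ncard_image,
    Set.ncard_coe_finset]
  exact fun a ha b hb hab => hinj ha hb (Sym2.congr_right.1 hab)

theorem IsMatching.exists_mem_splitStar {M : Finset (Sym2 V)} (hM : IsMatching M)
    (hcard : #M = #A + 1) (hMA : ∀ e ∈ M, (∃ a ∈ A, a ∈ e) ∨ ∃ a ∈ A, s(c, d a) = e)
    {w : Sym2 V → V} (hw : ∀ e, w e ∈ e) (hwA : ∀ e, (∃ a ∈ A, a ∈ e) → w e ∈ A) :
    ∃ e ∈ M, (∃ a ∈ A, a ∈ e) ∧ s(c, d (w e)) ∈ M := by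
  classical
  obtain ⟨a, ha, haM⟩ : ∃ a ∈ A, s(c, d a) ∈ M := by
    by_contra! hno
    have := hM.card_le fun e he => (hMA e he).resolve_right fun ⟨a, ha, h⟩ => hno a ha (h ▸ he)
    omega
  have hsplit : ∀ e ∈ M.erase s(c, d a), ∃ a ∈ A, a ∈ e := by
    intro e he
    obtain ⟨hne, he⟩ := mem_erase.1 he
    refine (hMA e he).resolve_right ?_
    rintro ⟨b, -, rfl⟩
    exact hne (hM _ he _ haM c (Sym2.mem_mk_left _ _) (Sym2.mem_mk_left _ _))
  -- the other `#A` edges of `M` meet `A` in distinct vertices, so one of them contains `a`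
  have hsurj : Set.SurjOn w (M.erase s(c, d a)) A :=
    surjOn_of_injOn_of_card_le w (fun e he => hwA e (hsplit e he))
      ((hM.subset (erase_subset _ _)).injOn fun e _ => hw e)
      (by rw [card_erase_of_mem haM, hcard, Nat.add_sub_cancel])
  obtain ⟨e, he, rfl⟩ := hsurj ha
  exact ⟨e, mem_of_mem_erase he, hsplit e he, haM⟩

theorem avoids_matching_splitStarGraph (hA : A.Nonempty) (hc : c ∉ A) (hd : ∀ a ∈ A, d a ∉ A)
    (hdc : ∀ a ∈ A, d a ≠ c) : Avoids (matching (#A + 1)) (splitStarGraph A c d) := by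
  classical
  obtain ⟨a₀, ha₀⟩ := hA
  choose w hw hwA using exists_endpoint A
  let f : Sym2 V → Sym2 V := fun e => if ∃ a ∈ A, a ∈ e then s(c, d (w e)) else s(a₀, c)
  refine avoids_matching_iff.2 ⟨f, fun e he => ?_, ?_⟩
  · rw [edgeSet_splitStarGraph hdc] at he ⊢
    by_cases heA : ∃ a ∈ A, a ∈ e
    · rw [show f e = s(c, d (w e)) from if_pos heA]
      refine ⟨.inr ⟨w e, hwA e heA, rfl⟩, fun heq => ?_⟩
      have hmem : w e ∈ s(c, d (w e)) := heq.symm ▸ hw e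
      rcases Sym2.mem_iff.1 hmem with h | h
      · exact hc (h ▸ hwA e heA)
      · exact hd _ (hwA e heA) (by rw [← h]; exact hwA e heA)
    · rw [show f e = s(a₀, c) from if_neg heA]
      refine ⟨.inl (mem_edgeSet_splitGraph.2 ⟨?_, a₀, ha₀, Sym2.mem_mk_left _ _⟩), ?_⟩
      · rw [Sym2.mk_isDiag_iff]
        exact fun h => hc (h ▸ ha₀)
      · exact fun h => heA (h ▸ ⟨a₀, ha₀, Sym2.mem_mk_left _ _⟩)
  · rintro ⟨M, hMH, hM, hcard, hfree⟩
    have hMA : ∀ e ∈ M, (∃ a ∈ A, a ∈ e) ∨ ∃ a ∈ A, s(c, d a) = e := fun e he => by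
      have heH := hMH he
      rw [edgeSet_splitStarGraph hdc] at heH
      exact heH.imp_left fun h => (mem_edgeSet_splitGraph.1 h).2
    obtain ⟨e, he, heA, hfe⟩ := hM.exists_mem_splitStar hcard hMA hw hwA
    exact hfree e he (by rwa [show f e = s(c, d (w e)) from if_pos heA])

theorem mem_hSet_matching {n u : ℕ} (hu : 1 ≤ u) (hn : 2 * u + 1 ≤ n) :
    u * (n - u) + u.choose 2 + u ∈ hSet n (matching (u + 1)) := by
  classical
  obtain ⟨A, -, rfl⟩ : ∃ A ⊆ (univ : Finset (Fin n)), #A = u :=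
    exists_subset_card_eq (by rw [card_fin]; omega)
  obtain ⟨c, hc⟩ : Aᶜ.Nonempty := by
    rw [← card_pos, card_compl, Fintype.card_fin]
    omega
  have hA : #A ≤ #(Aᶜ.erase c) := by
    rw [card_erase_of_mem hc, card_compl, Fintype.card_fin]
    omega
  have : Nonempty (Fin n) := ⟨c⟩
  obtain ⟨d, hd, hinj⟩ : ∃ d : Fin n → Fin n, (A : Set (Fin n)) ⊆ d ⁻¹' ↑(Aᶜ.erase c) ∧
      Set.InjOn d A :=
    A.finite_toSet.exists_injOn_of_encard_le
      (by simpa only [Set.encard_coe_eq_coe_finsetCard, Nat.cast_le])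
  have hd : ∀ a ∈ A, d a ∉ A ∧ d a ≠ c := fun a ha => by
    have := hd ha
    simpa [and_comm] using this
  have hc := mem_compl.1 hc
  refine ⟨splitStarGraph A c d, ?_, avoids_matching_splitStarGraph (card_pos.1 hu) hc
    (fun a ha => (hd a ha).1) (fun a ha => (hd a ha).2)⟩
  rw [ncard_edgeSet_splitStarGraph hc (fun a ha => (hd a ha).1) (fun a ha => (hd a ha).2) hinj,
    Fintype.card_fin]

theorem le_extremalNumber_matching {n u : ℕ} (hn : u ≤ n) :
    u * (n - u) + u.choose 2 ≤ SimpleGraph.extremalNumber n (matching (u + 1)) := by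
  classical
  obtain ⟨A, -, rfl⟩ : ∃ A ⊆ (univ : Finset (Fin n)), #A = u :=
    exists_subset_card_eq (by rwa [card_fin])
  have := SimpleGraph.card_edgeFinset_le_extremalNumber (free_matching_splitGraph A)
  rwa [card_edgeFinset_splitGraph, Fintype.card_fin] at this

end LowerBound

/-! ### Two disjoint edges -/

section TwoEdges

/-- `f` links the disjoint members of `E` if of any two disjoint members one is the image of the
other. For `E = E(H)` this says that `H` has no `f`-free copy of `2K₂`. -/
def LinksDisjoint (f : Sym2 V → Sym2 V) (E : Set (Sym2 V)) : Prop :=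
  ∀ e ∈ E, ∀ e' ∈ E, (∀ v ∈ e, v ∉ e') → f e = e' ∨ f e' = e

theorem not_hasFreeMatching_two_iff {H : SimpleGraph V} {f : Sym2 V → Sym2 V}
    (hf : ∀ e ∈ H.edgeSet, f e ≠ e) :
    ¬ HasFreeMatching H f 2 ↔ LinksDisjoint f H.edgeSet := by
  classical
  constructor
  · intro hfree e he e' he' hd
    by_contra! hne
    refine hfree ⟨{e, e'}, ?_, ?_, card_pair (ne_of_forall_notMem hd), ?_⟩
    · rw [coe_pair]
      exact Set.pair_subset he he'
    · simp only [IsMatching, mem_insert, mem_singleton]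
      grind
    · have := hf e he
      have := hf e' he'
      simp only [IsFree, mem_insert, mem_singleton]
      grind
  · rintro hlink ⟨M, hMH, hM, hcard, hfree⟩
    obtain ⟨e, e', hne, rfl⟩ := card_eq_two.1 hcard
    have he : e ∈ ({e, e'} : Finset (Sym2 V)) := mem_insert_self _ _
    have he' : e' ∈ ({e, e'} : Finset (Sym2 V)) := mem_insert_of_mem (mem_singleton_self _)
    rcases hlink e (hMH he) e' (hMH he') fun v hv hv' => hne (hM e he e' he' v hv hv') with h | h
    · exact hfree e he (h ▸ he')
    · exact hfree e' he' (h ▸ he)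

theorem avoids_matching_two_iff {H : SimpleGraph V} :
    Avoids (matching 2) H ↔ ∃ f : Sym2 V → Sym2 V,
      (∀ e ∈ H.edgeSet, f e ∈ H.edgeSet ∧ f e ≠ e) ∧ LinksDisjoint f H.edgeSet :=
  avoids_matching_iff.trans <| exists_congr fun _ => and_congr_right fun hf =>
    not_hasFreeMatching_two_iff fun e he => (hf e he).2

theorem sum_card_filter_le_of_linked {α : Type*} [DecidableEq α] {f : α → α} {X Y : Finset α}
    {r : α → α → Prop} [DecidableRel r]
    (h : ∀ x ∈ X, ∀ y ∈ Y, r x y → f x = y ∨ f y = x) :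
    ∑ y ∈ Y, #{x ∈ X | r x y} ≤ #X + #{y ∈ Y | f y ∈ X} := by
  calc ∑ y ∈ Y, #{x ∈ X | r x y}
      ≤ ∑ y ∈ Y, (#{x ∈ X | f x = y} + #{x ∈ X | f y = x}) := by
        refine sum_le_sum fun y hy => (card_le_card fun x hx => ?_).trans (card_union_le _ _)
        obtain ⟨hx, hr⟩ := mem_filter.1 hx
        simpa only [mem_union, mem_filter, hx, true_and] using h x hx y hy hr
    _ = ∑ y ∈ Y, #{x ∈ X | f x = y} + ∑ y ∈ Y, #{x ∈ X | f y = x} := sum_add_distrib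
    _ ≤ #X + #{y ∈ Y | f y ∈ X} := by
        refine Nat.add_le_add ?_ (le_of_eq ?_)
        · rw [sum_card_fiberwise_eq_card_filter]
          exact card_filter_le _ _
        · rw [card_filter]
          refine sum_congr rfl fun y _ => ?_
          rw [filter_eq]
          split_ifs <;> rfl

theorem two_mul_card_le_choose_of_intersecting {α : Type*} {N : Finset α}
    {P : Finset (Finset α)} {k : ℕ} (hN : #N = 2 * k) (hP : P ⊆ N.powersetCard k)
    (hmeet : ∀ s ∈ P, ∀ s' ∈ P, ¬ Disjoint s s') : 2 * #P ≤ (2 * k).choose k := by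
  classical
  have hPN : ∀ s ∈ P, s ⊆ N ∧ #s = k := fun s hs => mem_powersetCard.1 (hP hs)
  have hdisj : Disjoint P (P.image (N \ ·)) := by
    rw [disjoint_right]
    intro _ himage hmem
    obtain ⟨s, hs, rfl⟩ := mem_image.1 himage
    exact hmeet _ hmem _ hs sdiff_disjoint
  have hinj : Set.InjOn (N \ ·) (P : Set (Finset α)) := fun s hs s' hs' heq => by
    rw [← Finset.sdiff_sdiff_eq_self (hPN s hs).1, ← Finset.sdiff_sdiff_eq_self (hPN s' hs').1]
    exact congrArg (N \ ·) heq
  calc 2 * #P = #(P ∪ P.image (N \ ·)) := by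
        rw [card_union_of_disjoint hdisj, card_image_of_injOn hinj, two_mul]
    _ ≤ #(N.powersetCard k) := card_le_card <| union_subset hP <| image_subset_iff.2 fun s hs => by
        rw [mem_powersetCard, card_sdiff_of_subset (hPN s hs).1, hN, (hPN s hs).2]
        exact ⟨sdiff_subset, by omega⟩
    _ = (2 * k).choose k := by rw [card_powersetCard, hN]

theorem card_mul_sub_two_le_sum [DecidableEq V] (N : Finset V) (T : Finset (Sym2 V)) :
    #T * (#N - 2) ≤ ∑ g ∈ T, #(N \ g.toFinset) :=
  card_nsmul_le_sum _ _ _ fun g _ => (Nat.sub_le_sub_left (by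
    rw [Sym2.card_toFinset]
    split_ifs <;> omega) _).trans (le_card_sdiff _ _)

variable [Fintype V] [DecidableEq V] {H : SimpleGraph V} [DecidableRel H.Adj]
  {f : Sym2 V → Sym2 V} {v : V}

theorem card_edgeFinset_lt_degree_add_degree_add {x y : V} (hxy : H.Adj x y) :
    #H.edgeFinset < H.degree x + H.degree y + #{e ∈ H.edgeFinset | ∀ v ∈ e, v ∉ s(x, y)} := by
  have hcover : H.edgeFinset ⊆ (H.incidenceFinset x ∪ (H.incidenceFinset y).erase s(x, y)) ∪
      {e ∈ H.edgeFinset | ∀ v ∈ e, v ∉ s(x, y)} := by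
    intro e he
    simp only [H.incidenceFinset_eq_filter, mem_union, mem_erase, mem_filter, Sym2.mem_iff, he,
      true_and]
    grind
  have hy : s(x, y) ∈ H.incidenceFinset y := by
    rw [H.incidenceFinset_eq_filter, mem_filter, SimpleGraph.mem_edgeFinset]
    exact ⟨hxy, Sym2.mem_mk_right x y⟩
  have hle := (card_le_card hcover).trans (card_union_le _ _)
  have hle' := card_union_le (H.incidenceFinset x) ((H.incidenceFinset y).erase s(x, y))
  have hpos := card_pos.2 ⟨_, hy⟩
  rw [card_erase_of_mem hy] at hle'
  simp only [H.card_incidenceFinset_eq_degree] at hle' hpos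
  omega

theorem card_edgeFinset_eq_degree_add (v : V) :
    #H.edgeFinset = H.degree v + #{e ∈ H.edgeFinset | v ∉ e} := by
  rw [← card_filter_add_card_filter_not (s := H.edgeFinset) (fun e => v ∈ e),
    ← H.card_incidenceFinset_eq_degree, H.incidenceFinset_eq_filter]

theorem sum_card_sdiff_le (hlink : LinksDisjoint f H.edgeSet) {N : Finset V}
    (hN : N ⊆ H.neighborFinset v) :
    ∑ g ∈ {g ∈ H.edgeFinset | v ∉ g}, #(N \ g.toFinset) ≤
      #N + #{g ∈ H.edgeFinset | v ∉ g ∧ v ∈ f g} := by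
  let X := N.image fun w => s(v, w)
  have hX : ∀ g : Sym2 V, v ∉ g → #(N \ g.toFinset) ≤ #{e ∈ X | ∀ u ∈ e, u ∉ g} := by
    intro g hg
    rw [← card_image_of_injective (N \ g.toFinset) fun _ _ => (Sym2.congr_right (a := v)).1]
    refine card_le_card (image_subset_iff.2 fun w hw => ?_)
    rw [mem_sdiff, Sym2.mem_toFinset] at hw
    refine mem_filter.2 ⟨mem_image_of_mem _ hw.1, fun u hu => ?_⟩
    rcases Sym2.mem_iff.1 hu with rfl | rfl
    exacts [hg, hw.2]
  calc ∑ g ∈ {g ∈ H.edgeFinset | v ∉ g}, #(N \ g.toFinset)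
      ≤ ∑ g ∈ {g ∈ H.edgeFinset | v ∉ g}, #{e ∈ X | ∀ u ∈ e, u ∉ g} :=
        sum_le_sum fun g hg => hX g (mem_filter.1 hg).2
    _ ≤ #X + #{g ∈ {g ∈ H.edgeFinset | v ∉ g} | f g ∈ X} := by
        refine sum_card_filter_le_of_linked fun e he g hg => hlink e ?_ g
          (SimpleGraph.mem_edgeFinset.1 (mem_filter.1 hg).1)
        obtain ⟨w, hw, rfl⟩ := mem_image.1 he
        exact (H.mem_neighborFinset v w).1 (hN hw)
    _ ≤ #N + #{g ∈ H.edgeFinset | v ∉ g ∧ v ∈ f g} := by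
        refine Nat.add_le_add card_image_le ?_
        rw [filter_filter]
        refine card_le_card (monotone_filter_right _ fun g _ ⟨hg, hfg⟩ => ⟨hg, ?_⟩)
        obtain ⟨w, -, hw⟩ := mem_image.1 hfg
        exact hw ▸ Sym2.mem_mk_left v w

theorem exists_mem_mem_of_card_le (hlink : LinksDisjoint f H.edgeSet)
    (hcard : H.degree v + #{e ∈ H.edgeFinset | v ∉ e} ≤
      #{e ∈ H.edgeFinset | v ∉ e} * (H.degree v - 2)) :
    ∀ g ∈ H.edgeFinset, v ∉ g → ∀ g' ∈ H.edgeFinset, v ∉ g' → ∃ w ∈ g, w ∈ g' := by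
  have hle := (card_mul_sub_two_le_sum (H.neighborFinset v) {e ∈ H.edgeFinset | v ∉ e}).trans
    (sum_card_sdiff_le hlink subset_rfl)
  rw [H.card_neighborFinset_eq_degree, ← filter_filter] at hle
  have hfg := (card_filter_eq_iff
    (s := {e ∈ H.edgeFinset | v ∉ e}) (p := fun g => v ∈ f g)).1
      (le_antisymm (card_filter_le _ _) (by omega))
  intro g hg hvg g' hg' hvg'
  have hfg₁ := hfg g (mem_filter.2 ⟨hg, hvg⟩)
  have hfg₂ := hfg g' (mem_filter.2 ⟨hg', hvg'⟩)
  by_contra! hd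
  rcases hlink g (SimpleGraph.mem_edgeFinset.1 hg) g' (SimpleGraph.mem_edgeFinset.1 hg') hd with
    h | h
  · exact hvg' (h ▸ hfg₁)
  · exact hvg (h ▸ hfg₂)

theorem card_toFinset_of_mem_edgeFinset {g : Sym2 V} (hg : g ∈ H.edgeFinset) :
    #g.toFinset = 2 :=
  Sym2.card_toFinset_of_not_isDiag _ <|
    H.not_isDiag_of_mem_edgeSet (SimpleGraph.mem_edgeFinset.1 hg)

theorem toFinset_subset_neighborFinset_of_card_le (hlink : LinksDisjoint f H.edgeSet)
    (hcard : H.degree v + #{e ∈ H.edgeFinset | v ∉ e} ≤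
      #{e ∈ H.edgeFinset | v ∉ e} * (H.degree v - 2)) :
    ∀ g ∈ {e ∈ H.edgeFinset | v ∉ e}, g.toFinset ⊆ H.neighborFinset v := by
  have hlow : ∀ g ∈ {e ∈ H.edgeFinset | v ∉ e},
      H.degree v - 2 ≤ #(H.neighborFinset v \ g.toFinset) := by
    intro g hg
    rw [← card_toFinset_of_mem_edgeFinset (mem_filter.1 hg).1, ← H.card_neighborFinset_eq_degree]
    exact le_card_sdiff _ _
  have hle := sum_card_sdiff_le hlink (subset_refl (H.neighborFinset v))
  rw [H.card_neighborFinset_eq_degree, ← filter_filter] at hle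
  have hfilter := card_filter_le {e ∈ H.edgeFinset | v ∉ e} fun g => v ∈ f g
  have heq := (sum_eq_sum_iff_of_le hlow).1 <| le_antisymm (sum_le_sum hlow) <| by
    rw [sum_const, smul_eq_mul]
    omega
  intro g hg
  have hdeg : 2 < H.degree v := by
    have hpos := card_pos.2 ⟨g, hg⟩
    by_contra! h
    rw [Nat.sub_eq_zero_of_le h, mul_zero] at hcard
    omega
  have hg' := heq g hg
  have htwo := card_toFinset_of_mem_edgeFinset (mem_filter.1 hg).1
  rw [card_sdiff, H.card_neighborFinset_eq_degree] at hg'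
  exact inter_eq_left.1 (eq_of_subset_of_card_le inter_subset_left (by omega))

theorem card_ne_four_of_degree_eq_four (hlink : LinksDisjoint f H.edgeSet)
    (hv : H.degree v = 4) : #{e ∈ H.edgeFinset | v ∉ e} ≠ 4 := by
  intro hT
  have hcard : H.degree v + #{e ∈ H.edgeFinset | v ∉ e} ≤
      #{e ∈ H.edgeFinset | v ∉ e} * (H.degree v - 2) := by rw [hv, hT]
  have hmeet := exists_mem_mem_of_card_le hlink hcard
  have hsub := toFinset_subset_neighborFinset_of_card_le hlink hcard
  have hinj : Function.Injective (Sym2.toFinset : Sym2 V → Finset V) := fun g g' h =>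
    Sym2.ext fun u => by rw [← Sym2.mem_toFinset, h, Sym2.mem_toFinset]
  have hle := two_mul_card_le_choose_of_intersecting (k := 2) (N := H.neighborFinset v)
    (P := {e ∈ H.edgeFinset | v ∉ e}.image Sym2.toFinset)
    (by rw [H.card_neighborFinset_eq_degree, hv])
    (image_subset_iff.2 fun g hg => mem_powersetCard.2
      ⟨hsub g hg, card_toFinset_of_mem_edgeFinset (mem_filter.1 hg).1⟩)
    (by
      simp only [mem_image, mem_filter]
      rintro _ ⟨g, ⟨hg, hvg⟩, rfl⟩ _ ⟨g', ⟨hg', hvg'⟩, rfl⟩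
      obtain ⟨w, hw, hw'⟩ := hmeet g hg hvg g' hg' hvg'
      exact not_disjoint_iff.2 ⟨w, Sym2.mem_toFinset.2 hw, Sym2.mem_toFinset.2 hw'⟩)
  rw [card_image_of_injective _ hinj, hT] at hle
  norm_num [Nat.choose] at hle

theorem card_ne_two_of_degree_eq_six (hlink : LinksDisjoint f H.edgeSet)
    (hv : H.degree v = 6) : #{e ∈ H.edgeFinset | v ∉ e} ≠ 2 := by
  intro hT
  obtain ⟨g, g', hne, hTeq⟩ := card_eq_two.1 hT
  have hg : g ∈ {e ∈ H.edgeFinset | v ∉ e} := hTeq ▸ mem_insert_self _ _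
  have hg' : g' ∈ {e ∈ H.edgeFinset | v ∉ e} :=
    hTeq ▸ mem_insert_of_mem (mem_singleton_self _)
  rw [mem_filter] at hg hg'
  obtain ⟨w, hw, hw'⟩ :=
    exists_mem_mem_of_card_le hlink (by rw [hv, hT]) g hg.1 hg.2 g' hg'.1 hg'.2
  let N := H.neighborFinset v \ (g.toFinset ∪ g'.toFinset)
  have hN : 3 ≤ #N := by
    have hunion := card_union_add_card_inter g.toFinset g'.toFinset
    have hinter : 0 < #(g.toFinset ∩ g'.toFinset) :=
      card_pos.2 ⟨w, mem_inter.2 ⟨Sym2.mem_toFinset.2 hw, Sym2.mem_toFinset.2 hw'⟩⟩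
    have hle : #(H.neighborFinset v) - #(g.toFinset ∪ g'.toFinset) ≤ #N := le_card_sdiff _ _
    rw [card_toFinset_of_mem_edgeFinset hg.1, card_toFinset_of_mem_edgeFinset hg'.1] at hunion
    rw [H.card_neighborFinset_eq_degree, hv] at hle
    omega
  have hdisj : Disjoint N g.toFinset := disjoint_sdiff.symm.mono_right subset_union_left
  have hdisj' : Disjoint N g'.toFinset := disjoint_sdiff.symm.mono_right subset_union_right
  have hsum := sum_card_sdiff_le hlink (show N ⊆ H.neighborFinset v from sdiff_subset)
  rw [← filter_filter, hTeq, sum_pair hne,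
    sdiff_eq_self_of_disjoint hdisj, sdiff_eq_self_of_disjoint hdisj'] at hsum
  have hfilter := card_filter_le {g, g'} fun g => v ∈ f g
  rw [card_pair hne] at hfilter
  omega

end TwoEdges

theorem card_edgeFinset_le_of_degree_le_three [Fintype V] {H : SimpleGraph V} [DecidableRel H.Adj]
    {f : Sym2 V → Sym2 V} (hlink : LinksDisjoint f H.edgeSet) (hdeg : ∀ v, H.degree v ≤ 3) :
    #H.edgeFinset ≤ 7 := by
  classical
  have hlow : ∀ e ∈ H.edgeFinset,
      #H.edgeFinset - 5 ≤ #{e' ∈ H.edgeFinset | ∀ v ∈ e', v ∉ e} := by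
    intro e he
    induction e with | _ x y
    have := card_edgeFinset_lt_degree_add_degree_add (x := x) (y := y)
      (SimpleGraph.mem_edgeFinset.1 he)
    have := hdeg x
    have := hdeg y
    omega
  have hcount := (card_nsmul_le_sum _ _ _ hlow).trans <| sum_card_filter_le_of_linked (f := f)
    (r := fun e' e => ∀ v ∈ e', v ∉ e) fun e he e' he' => hlink e
      (SimpleGraph.mem_edgeFinset.1 he) e' (SimpleGraph.mem_edgeFinset.1 he')
  have := card_filter_le H.edgeFinset fun e => f e ∈ H.edgeFinset
  by_contra! hE
  have := Nat.mul_le_mul_left #H.edgeFinset (show 3 ≤ #H.edgeFinset - 5 by omega)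
  rw [smul_eq_mul] at hcount
  omega

theorem card_edgeFinset_le_of_avoids_two [Fintype V] [Nonempty V] {H : SimpleGraph V}
    [DecidableRel H.Adj] (hH : Avoids (matching 2) H) :
    #H.edgeFinset ≤ max (Fintype.card V) 7 := by
  classical
  obtain ⟨f, -, hlink⟩ := avoids_matching_two_iff.1 hH
  obtain ⟨v, hv⟩ := H.exists_maximal_degree_vertex
  rcases le_or_gt (H.degree v) 3 with h3 | h4
  · exact (card_edgeFinset_le_of_degree_le_three hlink fun u =>
      (H.degree_le_maxDegree u).trans (hv ▸ h3)).trans (le_max_right _ _)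
  by_contra! hE
  rw [max_lt_iff, card_edgeFinset_eq_degree_add v] at hE
  have hV := H.degree_lt_card_verts v
  have hcount := (card_mul_sub_two_le_sum (H.neighborFinset v) {e ∈ H.edgeFinset | v ∉ e}).trans
    (sum_card_sdiff_le hlink subset_rfl)
  have hT := card_filter_le {e ∈ H.edgeFinset | v ∉ e} fun g => v ∈ f g
  rw [H.card_neighborFinset_eq_degree, ← filter_filter] at hcount
  have hne4 := card_ne_four_of_degree_eq_four (v := v) hlink
  have hne2 := card_ne_two_of_degree_eq_six (v := v) hlink
  generalize #{e ∈ H.edgeFinset | v ∉ e} = k at *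
  have hk : k * (H.degree v - 2) ≤ H.degree v + k := hcount.trans (Nat.add_le_add_left hT _)
  generalize H.degree v = D at *
  have hD : D < 7 := by
    by_contra! h
    obtain ⟨j, rfl⟩ := Nat.exists_eq_add_of_le h
    have := Nat.mul_le_mul_right j (show 2 ≤ k by omega)
    rw [show 7 + j - 2 = j + 5 by omega, mul_add] at hk
    omega
  interval_cases D
  · exact hne4 rfl (by omega)
  · omega
  · exact hne2 rfl (by omega)

section SmallCases

theorem mem_hSet_matching_two_of_linksDisjoint {n m : ℕ} {E : Finset (Sym2 (Fin n))}
    {f : Sym2 (Fin n) → Sym2 (Fin n)} (hm : #E = m) (hE : ∀ e ∈ E, ¬ e.IsDiag)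
    (hf : ∀ e ∈ E, f e ∈ E ∧ f e ≠ e) (hlink : LinksDisjoint f E) :
    m ∈ hSet n (matching 2) := by
  have hH : (SimpleGraph.fromEdgeSet (E : Set (Sym2 (Fin n)))).edgeSet = E := by
    ext e
    rw [SimpleGraph.edgeSet_fromEdgeSet, Set.mem_sdiff, Sym2.mem_diagSet]
    exact and_iff_left_of_imp (hE e)
  refine ⟨SimpleGraph.fromEdgeSet E, by rw [hH, Set.ncard_coe_finset, hm],
    avoids_matching_two_iff.2 ⟨f, ?_⟩⟩
  rw [hH]
  exact ⟨hf, hlink⟩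

theorem six_mem_hSet_four : 6 ∈ hSet 4 (matching 2) :=
  mem_hSet_matching_two_of_linksDisjoint (n := 4)
    (E := {s(0, 1), s(0, 2), s(0, 3), s(1, 2), s(1, 3), s(2, 3)})
    (f := fun e => if e = s(0, 1) then s(2, 3) else if e = s(0, 2) then s(1, 3) else
      if e = s(0, 3) then s(1, 2) else if e = s(1, 2) then s(0, 3) else
      if e = s(1, 3) then s(0, 2) else s(0, 1))
    (by decide) (by decide) (by decide) (by unfold LinksDisjoint; decide)

/-- The edges of `K₄` on the vertices `0, 1, 2, 3`, together with a pendant edge at `0`. It gives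
the lower bound for `h(n, 2K₂)` when `n` is `5` or `6`. -/
def pendantEdges (n : ℕ) [NeZero n] : Finset (Sym2 (Fin n)) :=
  {s(0, 1), s(0, 2), s(0, 3), s(1, 2), s(1, 3), s(2, 3), s(0, 4)}

/-- The map that sends the edges of `K₄` at the vertex `0` to the opposite edges, and the latter to
the pendant edge. Its value `s(0, 1)` at the pendant edge is arbitrary. -/
def pendantMap (n : ℕ) [NeZero n] (e : Sym2 (Fin n)) : Sym2 (Fin n) :=
  if e = s(0, 1) then s(2, 3) else if e = s(0, 2) then s(1, 3) else
    if e = s(0, 3) then s(1, 2) else if e = s(0, 4) then s(0, 1) else s(0, 4)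

theorem seven_mem_hSet_five : 7 ∈ hSet 5 (matching 2) :=
  mem_hSet_matching_two_of_linksDisjoint (E := pendantEdges 5) (f := pendantMap 5)
    (by decide) (by decide) (by decide) (by unfold LinksDisjoint; decide)

theorem seven_mem_hSet_six : 7 ∈ hSet 6 (matching 2) :=
  mem_hSet_matching_two_of_linksDisjoint (E := pendantEdges 6) (f := pendantMap 6)
    (by decide) (by decide) (by decide) (by unfold LinksDisjoint; decide)

end SmallCases

theorem h_eq_of_forall_card_edgeFinset_le {W : Type*} {n m : ℕ} {G : SimpleGraph W}
    (hm : m ∈ hSet n G)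
    (hle : ∀ (H : SimpleGraph (Fin n)) [DecidableRel H.Adj], Avoids G H → #H.edgeFinset ≤ m) :
    h n G = m := by
  classical
  refine IsGreatest.csSup_eq ⟨hm, ?_⟩
  rintro _ ⟨H, rfl, hH⟩
  rw [← SimpleGraph.coe_edgeFinset, Set.ncard_coe_finset]
  exact hle H hH

theorem h_matching_two_eq_of_mem {n m : ℕ} [NeZero n] (hm : m ∈ hSet n (matching 2))
    (hmax : max n 7 = m) : h n (matching 2) = m :=
  h_eq_of_forall_card_edgeFinset_le hm fun _ _ hH => by
    simpa only [Fintype.card_fin, hmax] using card_edgeFinset_le_of_avoids_two hH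

theorem h_matching_two_four : h 4 (matching 2) = 6 :=
  h_eq_of_forall_card_edgeFinset_le six_mem_hSet_four fun H _ _ =>
    H.card_edgeFinset_le_card_choose_two

theorem h_matching_two {n : ℕ} (hn : 7 ≤ n) : h n (matching 2) = n := by
  have : NeZero n := ⟨by omega⟩
  have hstar := mem_hSet_matching (u := 1) le_rfl (show 2 * 1 + 1 ≤ n by omega)
  rw [one_mul, Nat.choose_eq_zero_of_lt one_lt_two, add_zero, Nat.sub_add_cancel (by omega)]
    at hstar
  exact h_matching_two_eq_of_mem hstar (max_eq_left hn)

theorem two_mul_add_one_le_of_threshold_le {n u : ℕ} (hn : threshold (u + 1) ≤ n) :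
    2 * u + 1 ≤ n := by
  unfold threshold at hn
  nlinarith

theorem h_matching_succ {n u : ℕ} (hu : 1 ≤ u) (hn : threshold (u + 1) ≤ n) :
    h n (matching (u + 1)) = u * (n - u) + u.choose 2 + u :=
  h_eq_of_forall_card_edgeFinset_le
    (mem_hSet_matching hu (two_mul_add_one_le_of_threshold_le hn)) fun _ _ hH => by
      simpa only [Fintype.card_fin] using
        card_edgeFinset_le_of_avoids (by rwa [Fintype.card_fin]) hH

theorem extremalNumber_matching_succ {n u : ℕ} (hn : threshold (u + 1) ≤ n) :
    SimpleGraph.extremalNumber n (matching (u + 1)) = u * (n - u) + u.choose 2 := by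
  have hu := two_mul_add_one_le_of_threshold_le hn
  refine le_antisymm ?_ (le_extremalNumber_matching (by omega))
  rw [← Fintype.card_fin n] at hn ⊢
  rw [SimpleGraph.extremalNumber_le_iff]
  exact fun _ _ hH => card_edgeFinset_le_of_free hn hH

end EdgeMapping

theorem mainTheorem1 :
    ((∀ n : ℕ, 7 ≤ n → EdgeMapping.h n (EdgeMapping.matching 2) = n) ∧
      EdgeMapping.h 4 (EdgeMapping.matching 2) = 6 ∧
      EdgeMapping.h 5 (EdgeMapping.matching 2) = 7 ∧
      EdgeMapping.h 6 (EdgeMapping.matching 2) = 7) ∧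
    (∀ t : ℕ, 3 ≤ t → ∃ n_t : ℕ, t ≤ n_t ∧ ∀ n : ℕ, n_t ≤ n →
      EdgeMapping.h n (EdgeMapping.matching t) =
        SimpleGraph.extremalNumber n (EdgeMapping.matching t) + (t - 1) ∧
      SimpleGraph.extremalNumber n (EdgeMapping.matching t) + (t - 1) =
        (t - 1) * (n - t + 1) + (t - 1).choose 2 + (t - 1)) := by
  open EdgeMapping in
  refine ⟨⟨fun n hn => h_matching_two hn, h_matching_two_four,
    h_matching_two_eq_of_mem seven_mem_hSet_five rfl,
    h_matching_two_eq_of_mem seven_mem_hSet_six rfl⟩,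
    fun t ht => ?_⟩
  obtain ⟨u, rfl⟩ := Nat.exists_eq_add_of_le' (show 1 ≤ t by omega)
  have hu {n : ℕ} (hn : threshold (u + 1) ≤ n) := two_mul_add_one_le_of_threshold_le hn
  refine ⟨threshold (u + 1), by linarith [hu le_rfl], fun n hn => ?_⟩
  have hsub : n - (u + 1) + 1 = n - u := by
    have := hu hn
    omega
  rw [h_matching_succ (by omega) hn, extremalNumber_matching_succ hn, Nat.add_sub_cancel, hsub]
  exact ⟨rfl, rfl⟩
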